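/- Let $X$ be a finite-dimensional euclidean (real) vector space, and let $\mathcal F$ be a finite set of linear subspaces of $X$ which is stable under intersections and satisfies $\{0\}\in\mathcal F$ and $X\notin\mathcal F$. Let $\mathbb S_X$ be the set of rays $\mathbb R_+v$, $v\in X\smallsetminus\{0\}$, and let $\overline X=X\sqcup\mathbb S_X$ be the spherical compactification of $X$, with the structure of a smooth manifold with boundary for which the bijection $$\Theta:\overline X\to\{(t,x)\in\mathbb R\times X \mid t^2+\|x\|^2=1,\ t\ge 0\},\qquad \Theta(x)=\frac{(1,x)}{\sqrt{1+\|x\|^2}}\ (x\in X),\qquad \Theta(\mathbb R_+v)=\frac{(0,v)}{\|v\|}$$ is a diffeomorphism. For a linear subspace $Y\subset X$ let $\mathbb S_Y\subset\mathbb S_X$ be the set of rays contained in $Y$ (so $\mathbb S_{\{0\}}=\emptyset$) and $\overline Y=Y\sqcup\mathbb S_Y\subset\overline X$ (the closure of $Y$ in $\overline X$). Put $\overline{\mathcal F}=\{\overline Y\mid Y\in\mathcal F\}$ and $\mathbb S_{\mathcal F}=\{\mathbb S_Y\mid Y\in\mathcal F\}$. A subset $P$ of an $n$-dimensional manifold with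 corners $M$ is a p-submanifold if every $x\in P$ has an open neighborhood $U$ in $M$ with a smooth chart $\phi:U\to\mathbb R^n_k=[0,\infty)^k\times\mathbb R^{n-k}$ and a set $J\subset\{1,\dots,n\}$ such that $\phi(P\cap U)=\{y\in\phi(U)\mid y_i=0 \text{ for } i\in J\}$. A clean semilattice of p-submanifolds of $M$ is a finite set $\mathcal S$ of p-submanifolds of $M$ such that, for all $P,Q\in\mathcal S$, one has $P\cap Q\in\mathcal S$ and $T_x(P\cap Q)=T_xP\cap T_xQ$ for every $x\in P\cap Q$. Then each of the three families $\overline{\mathcal F}$, $\mathbb S_{\mathcal F}$ and $\mathbb S_{\mathcal F}\cup\overline{\mathcal F}$ is a clean semilattice of p-submanifolds of $\overline X$. -/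

import Mathlib

noncomputable section

open Set Module
open scoped Manifold ContDiff

/-! ### The local models of manifolds with corners -/

/-- The model `ℝⁿ_k = [0, ∞)ᵏ × ℝⁿ⁻ᵏ` (the first `k` coordinates are nonnegative). -/
abbrev Orthant (n k : ℕ) : Type :=
  {x : EuclideanSpace ℝ (Fin n) // ∀ i : Fin n, (i : ℕ) < k → 0 ≤ x i}

/-- The inclusion `ℝⁿ_k ⊆ ℝⁿ` as a model with corners. -/
def orthantModel (n k : ℕ) : ModelWithCorners ℝ (EuclideanSpace ℝ (Fin n)) (Orthant n k) where
  toFun := Subtype.val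
  invFun x := ⟨WithLp.toLp 2 fun i ↦ if (i : ℕ) < k then max (x i) 0 else x i, by
    intro i hi
    simp [hi]⟩
  source := univ
  target := {x | ∀ i : Fin n, (i : ℕ) < k → 0 ≤ x i}
  map_source' x _ := x.property
  map_target' _ _ := mem_univ _
  left_inv' x _ := by
    apply Subtype.ext
    ext i
    by_cases hi : (i : ℕ) < k
    · simp [hi, x.2 i hi]
    · simp [hi]
  right_inv' x hx := by
    ext i
    by_cases hi : (i : ℕ) < k
    · simp [hi, hx i hi]
    · simp [hi]
  source_eq := rfl
  convex_range' := by
    simp only [instIsRCLikeNormedField, ↓reduceDIte]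
    apply Convex.convex_isRCLikeNormedField
    have : range (Subtype.val : Orthant n k → EuclideanSpace ℝ (Fin n)) =
        {x | ∀ i : Fin n, (i : ℕ) < k → 0 ≤ x i} := Subtype.range_val
    rw [this]
    intro x hx y hy a b ha hb _ i hi
    have h1 := hx i hi
    have h2 := hy i hi
    simp only [PiLp.add_apply, PiLp.smul_apply, smul_eq_mul]
    positivity
  nonempty_interior' := by
    have : range (Subtype.val : Orthant n k → EuclideanSpace ℝ (Fin n)) =
        {x | ∀ i : Fin n, (i : ℕ) < k → 0 ≤ x i} := Subtype.range_val
    rw [this]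
    refine ⟨WithLp.toLp 2 fun _ ↦ 1, ?_⟩
    have hopen : IsOpen {x : EuclideanSpace ℝ (Fin n) | ∀ i, 0 < x i} := by
      simp only [ofPred_forall]
      exact isOpen_iInter_of_finite fun i ↦ isOpen_lt continuous_const (by fun_prop)
    exact interior_maximal (fun x hx i _ ↦ (hx i).le) hopen (by simp)
  continuous_toFun := continuous_subtype_val
  continuous_invFun := by
    refine Continuous.subtype_mk ((PiLp.continuous_toLp 2 _).comp <| continuous_pi fun i ↦ ?_) _
    by_cases hi : (i : ℕ) < k
    · simp only [hi, if_true]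
      fun_prop
    · simp only [hi, if_false]
      fun_prop

/-- The model `L_{J,k}ⁿ = {x ∈ ℝⁿ_k | x_i = 0 for i ∈ J}` of a p-submanifold. -/
def orthantFace {n k : ℕ} (J : Finset (Fin n)) : Set (Orthant n k) :=
  {x | ∀ i ∈ J, x.1 i = 0}

/-! ### p-submanifolds and clean intersections in a manifold with corners -/

section Corners

variable {n : ℕ} {H : Type*} [TopologicalSpace H]
  (I : ModelWithCorners ℝ (EuclideanSpace ℝ (Fin n)) H)
  {M : Type*} [TopologicalSpace M] [ChartedSpace H M]

/-- A smooth chart `φ : U → ℝⁿ_k` of `M`: a diffeomorphism from an open subset of `M` onto an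
open subset of `ℝⁿ_k`. -/
structure IsCornerChart {k : ℕ} (φ : OpenPartialHomeomorph M (Orthant n k)) : Prop where
  contMDiffOn : ContMDiffOn I (orthantModel n k) ∞ φ φ.source
  contMDiffOn_symm : ContMDiffOn (orthantModel n k) I ∞ φ.symm φ.target

/-- `P ⊆ M` is a p-submanifold: near each of its points some smooth chart `φ : U → ℝⁿ_k` of `M`
satisfies `φ(P ∩ U) = L_{J,k}ⁿ ∩ φ(U)`. -/
def IsPSubmanifold (P : Set M) : Prop :=
  ∀ x ∈ P, ∃ k ≤ n, ∃ (φ : OpenPartialHomeomorph M (Orthant n k)) (J : Finset (Fin n)),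
    IsCornerChart I φ ∧ x ∈ φ.source ∧ φ '' (P ∩ φ.source) = orthantFace J ∩ φ.target

/-- The inward pointing tangent vectors `γ'(0)` of `P` at `x`, for smooth curves
`γ : [0, ε) → M` inside `P` with `γ(0) = x`. -/
def inwardTangentVectors (P : Set M) (x : M) : Set (TangentSpace I x) :=
  {v | ∃ (γ : ℝ → M) (ε : ℝ) (hx : γ 0 = x), 0 < ε ∧ ContMDiffOn 𝓘(ℝ, ℝ) I ∞ γ (Ico 0 ε) ∧
    MapsTo γ (Ico 0 ε) P ∧
    v = hx ▸ (mfderivWithin 𝓘(ℝ, ℝ) I γ (Ico 0 ε) 0 (1 : ℝ) : TangentSpace I (γ 0))}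

/-- The tangent space `T_x P ⊆ T_x M` of a p-submanifold: the linear span of the inward pointing
tangent vectors. -/
def tangentSubspace (P : Set M) (x : M) : Submodule ℝ (TangentSpace I x) :=
  Submodule.span ℝ (inwardTangentVectors I P x)

/-- `P` and `Q` intersect cleanly: `P`, `Q`, `P ∩ Q` are p-submanifolds and
`T_x (P ∩ Q) = T_x P ∩ T_x Q` on `P ∩ Q`. -/
structure IntersectCleanly (P Q : Set M) : Prop where
  left : IsPSubmanifold I P
  right : IsPSubmanifold I Q
  inter : IsPSubmanifold I (P ∩ Q)
  tangent : ∀ x ∈ P ∩ Q, tangentSubspace I (P ∩ Q) x = tangentSubspace I P x ⊓ tangentSubspace I Q x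

/-- A clean semilattice of p-submanifolds of the manifold with corners `M`: a finite family of
p-submanifolds, stable under intersections, whose members pairwise intersect cleanly. -/
structure IsCleanSemilattice [IsManifold I ∞ M] (S : Set (Set M)) : Prop where
  finite : S.Finite
  isPSubmanifold : ∀ P ∈ S, IsPSubmanifold I P
  inter_mem : ∀ P ∈ S, ∀ Q ∈ S, P ∩ Q ∈ S
  clean : ∀ P ∈ S, ∀ Q ∈ S, IntersectCleanly I P Q

end Corners

/-! ### The half-sphere -/

section HalfSphere

variable (X : Type*) [NormedAddCommGroup X] [InnerProductSpace ℝ X]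

/-- The half-sphere `{(t, x) ∈ ℝ × X | t² + ‖x‖² = 1, t ≥ 0}`. -/
abbrev HalfSphere : Type _ :=
  {p : ℝ × X // p.1 ^ 2 + ‖p.2‖ ^ 2 = 1 ∧ 0 ≤ p.1}

variable {X}

variable {n : ℕ} [NeZero n] (b : OrthonormalBasis (Fin n) ℝ X)

/-- Coordinates on `ℝ × X` with the coordinate along `b 0` replaced by the `ℝ`-component. -/
def swapCoord (p : ℝ × X) : EuclideanSpace ℝ (Fin n) :=
  WithLp.toLp 2 fun i ↦ if i = 0 then p.1 else b.repr p.2 i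

/-- Stereographic projection from the boundary point `(0, s • b 0)`, `s = ±1`. -/
def halfStereo (s : ℝ) (p : ℝ × X) : EuclideanSpace ℝ (Fin n) :=
  (1 - s * b.repr p.2 0)⁻¹ • swapCoord b p

/-- Inverse of the stereographic projection from `(0, s • b 0)`. -/
def halfStereoInv (s : ℝ) (w : EuclideanSpace ℝ (Fin n)) : ℝ × X :=
  (‖w‖ ^ 2 + 1)⁻¹ • (2 * w 0, b.repr.symm (WithLp.toLp 2 fun i ↦
    if i = 0 then s * (‖w‖ ^ 2 - 1) else 2 * w i))

variable {b} {s : ℝ}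

theorem repr_sq_le {p : ℝ × X} (hp : p.1 ^ 2 + ‖p.2‖ ^ 2 = 1) : (b.repr p.2 0) ^ 2 ≤ 1 := by
  have h1 : ‖b.repr p.2 0‖ ≤ ‖b.repr p.2‖ := PiLp.norm_apply_le _ _
  rw [b.repr.norm_map, Real.norm_eq_abs] at h1
  have := abs_nonneg (b.repr p.2 0)
  have h3 := sq_abs (b.repr p.2 0)
  nlinarith [sq_nonneg p.1]

theorem one_sub_repr_nonneg (hs : s * s = 1) {p : ℝ × X} (hp : p.1 ^ 2 + ‖p.2‖ ^ 2 = 1) :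
    0 ≤ 1 - s * b.repr p.2 0 := by
  have := repr_sq_le (b := b) hp
  have h : (s * b.repr p.2 0) ^ 2 ≤ 1 := by
    calc (s * b.repr p.2 0) ^ 2 = (s * s) * (b.repr p.2 0) ^ 2 := by ring
      _ ≤ 1 := by rw [hs]; linarith
  nlinarith

theorem norm_swapCoord_sq (p : ℝ × X) :
    ‖swapCoord b p‖ ^ 2 = p.1 ^ 2 + ‖p.2‖ ^ 2 - (b.repr p.2 0) ^ 2 := by
  rw [← b.repr.norm_map p.2, EuclideanSpace.real_norm_sq_eq, EuclideanSpace.real_norm_sq_eq,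
    ← Finset.add_sum_erase _ _ (Finset.mem_univ (0 : Fin n)),
    ← Finset.add_sum_erase _ (fun i ↦ (b.repr p.2).ofLp i ^ 2) (Finset.mem_univ (0 : Fin n))]
  have : ∑ x ∈ Finset.univ.erase 0, (swapCoord b p).ofLp x ^ 2 =
      ∑ x ∈ Finset.univ.erase 0, (b.repr p.2).ofLp x ^ 2 :=
    Finset.sum_congr rfl fun i hi ↦ by simp [swapCoord, Finset.ne_of_mem_erase hi]
  rw [this]
  simp only [swapCoord, if_true]
  ring

theorem halfStereoInv_mem (hs : s * s = 1) (w : EuclideanSpace ℝ (Fin n)) :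
    (halfStereoInv b s w).1 ^ 2 + ‖(halfStereoInv b s w).2‖ ^ 2 = 1 := by
  have hpos : (0 : ℝ) < ‖w‖ ^ 2 + 1 := by positivity
  have key : ‖(WithLp.toLp 2 fun i ↦ if i = 0 then s * (‖w‖ ^ 2 - 1) else 2 * w i :
      EuclideanSpace ℝ (Fin n))‖ ^ 2 = (‖w‖ ^ 2 + 1) ^ 2 - (2 * w 0) ^ 2 := by
    have h2 : ‖w‖ ^ 2 = (w 0) ^ 2 + ∑ i ∈ Finset.univ.erase 0, (w i) ^ 2 := by
      rw [EuclideanSpace.real_norm_sq_eq, ← Finset.add_sum_erase _ _ (Finset.mem_univ (0 : Fin n))]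
    rw [EuclideanSpace.real_norm_sq_eq, ← Finset.add_sum_erase _ _ (Finset.mem_univ (0 : Fin n))]
    have : ∑ x ∈ Finset.univ.erase 0, (if x = 0 then s * (‖w‖ ^ 2 - 1) else 2 * w x) ^ 2 =
        4 * ∑ i ∈ Finset.univ.erase 0, (w i) ^ 2 := by
      rw [Finset.mul_sum]
      exact Finset.sum_congr rfl fun i hi ↦ by simp [Finset.ne_of_mem_erase hi]; ring
    simp only [if_true] at this ⊢
    rw [this]
    linear_combination (‖w‖ ^ 2 - 1) ^ 2 * hs - 4 * h2
  simp only [halfStereoInv, Prod.smul_mk, norm_smul, b.repr.symm.norm_map, mul_pow, key,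
    smul_eq_mul, Real.norm_eq_abs, sq_abs]
  field_simp
  ring

theorem halfStereoInv_halfStereo (hs : s * s = 1) {p : ℝ × X} (hp : p.1 ^ 2 + ‖p.2‖ ^ 2 = 1)
    (h : s * b.repr p.2 0 ≠ 1) : halfStereoInv b s (halfStereo b s p) = p := by
  have hD : 1 - s * b.repr p.2 0 ≠ 0 := fun h' ↦ h (by linarith)
  have hN : ‖halfStereo b s p‖ ^ 2 = (1 + s * b.repr p.2 0) * (1 - s * b.repr p.2 0)⁻¹ := by
    rw [halfStereo, norm_smul, mul_pow, norm_swapCoord_sq, hp, Real.norm_eq_abs, sq_abs]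
    field_simp
    linear_combination (b.repr p.2 0) ^ 2 * hs
  have hN1 : (‖halfStereo b s p‖ ^ 2 + 1)⁻¹ = (1 - s * b.repr p.2 0) / 2 := by
    rw [hN]
    field_simp
    ring
  rw [halfStereoInv, hN1, hN]
  refine Prod.ext ?_ ?_
  · simp [halfStereo, swapCoord]
    field_simp
  · rw [Prod.smul_mk]
    simp only
    apply b.repr.injective
    rw [map_smul, b.repr.apply_symm_apply]
    ext i
    by_cases hi : i = 0
    · subst hi
      simp
      field_simp
      linear_combination 2 * (b.repr p.2 0) * hs
    · simp [hi, halfStereo, swapCoord]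
      field_simp

theorem repr_halfStereoInv (w : EuclideanSpace ℝ (Fin n)) :
    b.repr (halfStereoInv b s w).2 0 = (‖w‖ ^ 2 + 1)⁻¹ * (s * (‖w‖ ^ 2 - 1)) := by
  simp [halfStereoInv]

theorem halfStereoInv_ne (hs : s * s = 1) (w : EuclideanSpace ℝ (Fin n)) :
    s * b.repr (halfStereoInv b s w).2 0 ≠ 1 := by
  have hpos : (0 : ℝ) < ‖w‖ ^ 2 + 1 := by positivity
  rw [repr_halfStereoInv]
  intro h
  field_simp at h
  have : s ^ 2 = 1 := by rw [sq, hs]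
  rw [this] at h
  linarith

theorem halfStereo_halfStereoInv (hs : s * s = 1) (w : EuclideanSpace ℝ (Fin n)) :
    halfStereo b s (halfStereoInv b s w) = w := by
  have hpos : (0 : ℝ) < ‖w‖ ^ 2 + 1 := by positivity
  have hD : (1 - s * b.repr (halfStereoInv b s w).2 0)⁻¹ = (‖w‖ ^ 2 + 1) / 2 := by
    rw [repr_halfStereoInv]
    have : 1 - s * ((‖w‖ ^ 2 + 1)⁻¹ * (s * (‖w‖ ^ 2 - 1))) = 2 / (‖w‖ ^ 2 + 1) := by
      field_simp
      linear_combination (1 - ‖w‖ ^ 2) * hs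
    rw [this, inv_div]
  rw [halfStereo, hD]
  ext i
  by_cases hi : i = 0
  · subst hi
    simp [swapCoord, halfStereoInv]
    field_simp
  · simp [hi, swapCoord, halfStereoInv]
    field_simp

theorem contDiff_swapCoord : ContDiff ℝ ∞ (swapCoord b) := by
  rw [contDiff_euclidean]
  intro i
  by_cases hi : i = 0
  · simp only [swapCoord, hi, if_true]
    exact contDiff_fst
  · simp only [swapCoord, hi, if_false]
    exact contDiff_euclidean.1 (b.repr.contDiff.comp contDiff_snd) i

theorem contDiffOn_halfStereo :
    ContDiffOn ℝ ∞ (halfStereo b s) {p | s * b.repr p.2 0 ≠ 1} := by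
  have h0 : ContDiff ℝ ∞ fun p : ℝ × X ↦ b.repr p.2 0 :=
    contDiff_euclidean.1 (b.repr.contDiff.comp contDiff_snd) 0
  have h1 : ContDiffOn ℝ ∞ (fun p : ℝ × X ↦ (1 - s * b.repr p.2 0)⁻¹)
      {p | s * b.repr p.2 0 ≠ 1} :=
    (contDiff_const.sub (contDiff_const.mul h0)).contDiffOn.inv
      fun p hp h ↦ hp (by linarith)
  exact h1.smul contDiff_swapCoord.contDiffOn

theorem contDiff_halfStereoInv : ContDiff ℝ ∞ (halfStereoInv b s) := by
  have hc (i : Fin n) : ContDiff ℝ ∞ fun w : EuclideanSpace ℝ (Fin n) ↦ w i :=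
    contDiff_euclidean.1 contDiff_id i
  have h0 : ContDiff ℝ ∞ fun w : EuclideanSpace ℝ (Fin n) ↦ ‖w‖ ^ 2 := contDiff_norm_sq ℝ
  have h1 : ContDiff ℝ ∞ fun w : EuclideanSpace ℝ (Fin n) ↦ (‖w‖ ^ 2 + 1)⁻¹ :=
    (h0.add contDiff_const).inv fun w ↦ by positivity
  have h2 : ContDiff ℝ ∞ fun w : EuclideanSpace ℝ (Fin n) ↦ 2 * w 0 :=
    contDiff_const.mul (hc 0)
  refine h1.smul (h2.prodMk (b.repr.symm.contDiff.comp ?_))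
  rw [contDiff_euclidean]
  intro i
  by_cases hi : i = 0
  · simp only [hi, if_true]
    exact contDiff_const.mul (h0.sub contDiff_const)
  · simp only [hi, if_false]
    exact contDiff_const.mul (hc i)

variable (b s)

/-- Stereographic projection of the half-sphere from `(0, s • b 0)`, `s = ±1`, as a chart with
values in `ℝⁿ_1`. -/
def halfSphereChart (hs : s * s = 1) : OpenPartialHomeomorph (HalfSphere X) (Orthant n 1) where
  toFun p := ⟨halfStereo b s p.1, fun i hi ↦ by
    have hi : i = 0 := Fin.ext (by simpa using hi)
    have := one_sub_repr_nonneg (b := b) hs p.2.1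
    have := p.2.2
    simp only [halfStereo, swapCoord, hi, PiLp.smul_apply, if_true, smul_eq_mul]
    positivity⟩
  invFun w := ⟨halfStereoInv b s w.1, halfStereoInv_mem hs w.1, by
    have : 0 ≤ w.1 0 := w.2 0 (by simp)
    simp only [halfStereoInv, Prod.smul_mk, smul_eq_mul]
    positivity⟩
  source := {p | s * b.repr p.1.2 0 ≠ 1}
  target := univ
  map_source' _ _ := mem_univ _
  map_target' w _ := halfStereoInv_ne hs w.1
  left_inv' p hp := Subtype.ext (halfStereoInv_halfStereo hs p.2.1 hp)
  right_inv' w _ := Subtype.ext (halfStereo_halfStereoInv hs w.1)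
  open_source := by
    apply isOpen_ne_fun <;> fun_prop
  open_target := isOpen_univ
  continuousOn_toFun := by
    refine Topology.IsInducing.subtypeVal.continuousOn_iff.2 ?_
    exact contDiffOn_halfStereo.continuousOn.comp continuous_subtype_val.continuousOn
      fun p hp ↦ hp
  continuousOn_invFun := (Continuous.subtype_mk
    (contDiff_halfStereoInv.continuous.comp continuous_subtype_val) _).continuousOn

variable (X) in
theorem neZero_finrank [FiniteDimensional ℝ X] [Nontrivial X] : NeZero (finrank ℝ X) :=
  NeZero.of_pos finrank_pos

attribute [local instance] neZero_finrank

variable [FiniteDimensional ℝ X] [Nontrivial X]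

instance : ChartedSpace (Orthant (finrank ℝ X) 1) (HalfSphere X) where
  atlas := {φ | ∃ (s : ℝ) (hs : s * s = 1), φ = halfSphereChart (stdOrthonormalBasis ℝ X) s hs}
  chartAt p := if (stdOrthonormalBasis ℝ X).repr p.1.2 0 ≤ 0
    then halfSphereChart (stdOrthonormalBasis ℝ X) 1 (by norm_num)
    else halfSphereChart (stdOrthonormalBasis ℝ X) (-1) (by norm_num)
  mem_chart_source p := by
    split_ifs with h
    · change 1 * _ ≠ (1 : ℝ)
      linarith
    · change -1 * _ ≠ (1 : ℝ)
      linarith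
  chart_mem_atlas p := by
    split_ifs
    · exact ⟨1, _, rfl⟩
    · exact ⟨-1, _, rfl⟩

instance : IsManifold (orthantModel (finrank ℝ X) 1) ∞ (HalfSphere X) :=
  isManifold_of_contDiffOn _ _ _ (by
    rintro _ _ ⟨s, hs, rfl⟩ ⟨s', hs', rfl⟩
    set b := stdOrthonormalBasis ℝ X
    have key : ContDiffOn ℝ ∞ (halfStereo b s' ∘ halfStereoInv b s)
        {w | s' * b.repr (halfStereoInv b s w).2 0 ≠ 1} :=
      contDiffOn_halfStereo.comp contDiff_halfStereoInv.contDiffOn fun w hw ↦ hw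
    refine (key.mono ?_).congr ?_
    · rintro w ⟨hw, w, rfl⟩
      have := hw.2
      simpa using! this
    · rintro w ⟨hw, w, rfl⟩
      simp only [Function.comp_apply, ModelWithCorners.left_inv]
      rfl)

end HalfSphere

/-! ### The spherical compactification -/

/-- The spherical compactification `X̄ = X ⊔ 𝕊_X`, where `𝕊_X` is the set of rays of `X`
emanating from `0`. -/
inductive SphericalCompactification (X : Type*) [AddCommGroup X] [Module ℝ X]
  /-- a point of `X` -/
  | ofPoint (x : X) : SphericalCompactification X
  /-- a point at infinity, that is, a ray `ℝ₊v` -/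
  | ofRay (r : Module.Ray ℝ X) : SphericalCompactification X

namespace SphericalCompactification

section Sets

variable {X : Type*} [AddCommGroup X] [Module ℝ X]

/-- The sphere at infinity `𝕊_Y ⊆ 𝕊_X ⊆ X̄` of a linear subspace `Y`: the set of the rays
contained in `Y`. -/
def sphereAtInfinity (Y : Submodule ℝ X) : Set (SphericalCompactification X) :=
  {q | ∃ (v : X) (hv : v ≠ 0), v ∈ Y ∧ q = ofRay (rayOfNeZero ℝ v hv)}

/-- The spherical compactification `Ȳ = Y ⊔ 𝕊_Y` of a linear subspace `Y`, as a subset of `X̄`. -/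
def compactification (Y : Submodule ℝ X) : Set (SphericalCompactification X) :=
  ofPoint '' (Y : Set X) ∪ sphereAtInfinity Y

/-- The family `F̄ = {Ȳ | Y ∈ F}`. -/
def compactifications (F : Set (Submodule ℝ X)) : Set (Set (SphericalCompactification X)) :=
  compactification '' F

/-- The family `𝕊_F = {𝕊_Y | Y ∈ F}`. -/
def spheresAtInfinity (F : Set (Submodule ℝ X)) : Set (Set (SphericalCompactification X)) :=
  sphereAtInfinity '' F

end Sets

variable {X : Type*} [NormedAddCommGroup X] [InnerProductSpace ℝ X]

/-- The map `Θ : X̄ → {(t, x) ∈ ℝ × X | t² + ‖x‖² = 1, t ≥ 0}` with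
`Θ(x) = (1 + ‖x‖²)^{-1/2} (1, x)` and `Θ(ℝ₊v) = ‖v‖⁻¹ (0, v)`. -/
def theta : SphericalCompactification X → HalfSphere X
  | ofPoint x => ⟨(√(1 + ‖x‖ ^ 2))⁻¹ • ((1 : ℝ), x), by
      have h : (0 : ℝ) < 1 + ‖x‖ ^ 2 := by positivity
      simp only [Prod.smul_mk, smul_eq_mul, mul_one, norm_smul, norm_inv, Real.norm_eq_abs,
        mul_pow, inv_pow, sq_abs, Real.sq_sqrt h.le]
      field_simp, by
      simp only [Prod.smul_mk, smul_eq_mul]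
      positivity⟩
  | ofRay r => ⟨‖r.someVector‖⁻¹ • ((0 : ℝ), r.someVector), by
      have h : ‖r.someVector‖ ≠ 0 := norm_ne_zero_iff.2 r.someVector_ne_zero
      simp [norm_smul, h], by simp⟩

/-- The value `Θ(ℝ₊v) = ‖v‖⁻¹ (0, v)` does not depend on the vector `v` spanning the ray. -/
theorem theta_ofRay (v : X) (hv : v ≠ 0) :
    (theta (ofRay (rayOfNeZero ℝ v hv))).1 = ‖v‖⁻¹ • ((0 : ℝ), v) := by
  set r := rayOfNeZero ℝ v hv with hr
  have h : SameRay ℝ r.someVector v := by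
    rw [← ray_eq_iff r.someVector_ne_zero hv, r.someVector_ray]
  have := (sameRay_iff_inv_norm_smul_eq_of_ne r.someVector_ne_zero hv).1 h
  simp only [theta, Prod.smul_mk, this, smul_zero]

/-- The inverse `Θ⁻¹` of `Θ`. -/
def thetaInv (p : HalfSphere X) : SphericalCompactification X :=
  open Classical in
  if h : p.1.1 = 0 then ofRay (rayOfNeZero ℝ p.1.2 (by
    intro h'
    have := p.2.1
    simp [h, h'] at this))
  else ofPoint (p.1.1⁻¹ • p.1.2)

variable (X) in
/-- The bijection `Θ` from `X̄` to the half-sphere. -/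
def thetaEquiv : SphericalCompactification X ≃ HalfSphere X where
  toFun := theta
  invFun := thetaInv
  left_inv q := by
    cases q with
    | ofPoint x =>
      have h : (0 : ℝ) < √(1 + ‖x‖ ^ 2) := by positivity
      simp [thetaInv, theta, h.ne', smul_smul]
    | ofRay r =>
      have h : 0 < ‖r.someVector‖⁻¹ := inv_pos.2 (norm_pos_iff.2 r.someVector_ne_zero)
      simp only [thetaInv, theta, Prod.smul_mk, smul_zero, dite_true]
      congr 1
      conv_rhs => rw [← r.someVector_ray]
      rw [ray_eq_iff]
      exact SameRay.sameRay_pos_smul_left _ h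
  right_inv p := by
    apply Subtype.ext
    have hp := p.2.1
    by_cases h : p.1.1 = 0
    · simp only [thetaInv, h, dite_true]
      rw [theta_ofRay]
      rw [h] at hp
      have h1 : ‖p.1.2‖ = 1 := by
        rw [← sq_eq_sq₀ (norm_nonneg _) zero_le_one]
        linarith
      simp only [h1, inv_one, one_smul]
      exact Prod.ext h.symm rfl
    · have hpos : 0 < p.1.1 := lt_of_le_of_ne p.2.2 (Ne.symm h)
      have h1 : 1 + ‖p.1.1⁻¹ • p.1.2‖ ^ 2 = (p.1.1⁻¹) ^ 2 := by
        rw [norm_smul, mul_pow, Real.norm_eq_abs, sq_abs]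
        field_simp
        linarith
      simp only [thetaInv, h, dite_false, theta, h1]
      rw [Real.sqrt_sq (inv_pos.2 hpos).le, inv_inv]
      refine Prod.ext ?_ ?_
      · simp
      · simp [smul_smul, h]

/-- The topology on `X̄` for which `Θ` is a homeomorphism. -/
instance : TopologicalSpace (SphericalCompactification X) :=
  TopologicalSpace.induced (thetaEquiv X) inferInstance

variable (X) in
/-- The homeomorphism `Θ`. -/
def thetaHomeomorph : SphericalCompactification X ≃ₜ HalfSphere X :=
  (thetaEquiv X).toHomeomorphOfIsInducing ⟨rfl⟩

/-- The subset `Ȳ` is the closure of `Y` in `X̄`. -/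
theorem closure_image_ofPoint [FiniteDimensional ℝ X] (Y : Submodule ℝ X) :
    closure (ofPoint '' (Y : Set X)) = compactification Y := by
  have hpre : compactification Y = (fun q : SphericalCompactification X ↦ (theta q).1.2) ⁻¹' Y := by
    ext q
    cases q with
    | ofPoint x =>
      have h : (√(1 + ‖x‖ ^ 2))⁻¹ ≠ 0 := by positivity
      simp [compactification, sphereAtInfinity, theta, Y.smul_mem_iff h]
    | ofRay r =>
      induction r using Module.Ray.ind with
      | h v hv =>
      have hn : ‖v‖⁻¹ ≠ 0 := inv_ne_zero (norm_ne_zero_iff.2 hv)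
      simp only [compactification, sphereAtInfinity, mem_union, mem_image, reduceCtorEq, and_false,
        exists_false, false_or, mem_preimage, theta_ofRay, Prod.smul_mk, SetLike.mem_coe,
        Y.smul_mem_iff hn, mem_ofPred_eq, ofRay.injEq]
      constructor
      · rintro ⟨u, hu, huY, h⟩
        obtain ⟨a, -, ha⟩ := ((ray_eq_iff hv hu).1 h).symm.exists_pos_left hu hv
        rw [← ha]
        exact Y.smul_mem _ huY
      · intro h
        exact ⟨v, hv, h, rfl⟩
  have hcont : Continuous (theta : SphericalCompactification X → HalfSphere X) :=
    (thetaHomeomorph X).continuous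
  apply subset_antisymm
  · refine closure_minimal (t := compactification Y) subset_union_left ?_
    rw [hpre]
    exact Y.closed_of_finiteDimensional.preimage
      (continuous_snd.comp (continuous_subtype_val.comp hcont))
  · rintro q (hq | ⟨v, hv, hvY, rfl⟩)
    · exact subset_closure hq
    · have hlim : Filter.Tendsto (fun t : ℝ ↦ (ofPoint (t • v) : SphericalCompactification X))
          Filter.atTop (nhds (ofRay (rayOfNeZero ℝ v hv))) := by
        rw [(thetaHomeomorph X).isInducing.tendsto_nhds_iff, tendsto_subtype_rng]
        change Filter.Tendsto (fun t : ℝ ↦ (theta (ofPoint (t • v))).1) _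
          (nhds (theta (ofRay (rayOfNeZero ℝ v hv))).1)
        rw [theta_ofRay]
        have hg : ContinuousAt (fun e : ℝ ↦ (√(e ^ 2 + ‖v‖ ^ 2))⁻¹ • (e, v)) 0 := by
          have : √((0 : ℝ) ^ 2 + ‖v‖ ^ 2) ≠ 0 := by
            have := norm_pos_iff.2 hv
            positivity
          fun_prop (disch := assumption)
        have hg' := hg.tendsto.comp tendsto_inv_atTop_zero
        simp only [ne_eq, OfNat.ofNat_ne_zero, not_false_eq_true, zero_pow, zero_add,
          Real.sqrt_sq (norm_nonneg v)] at hg'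
        refine hg'.congr' ?_
        filter_upwards [Filter.eventually_gt_atTop 0] with t ht
        have h1 : 1 + ‖t • v‖ ^ 2 = t ^ 2 * (t⁻¹ ^ 2 + ‖v‖ ^ 2) := by
          rw [norm_smul, mul_pow, Real.norm_eq_abs, sq_abs]
          field_simp
        simp only [Function.comp_apply, theta, h1]
        rw [Real.sqrt_mul (sq_nonneg t), Real.sqrt_sq ht.le, mul_inv]
        refine Prod.ext ?_ ?_
        · simp [mul_comm]
        · simp only [Prod.smul_mk, smul_smul]
          congr 1
          field_simp
      exact mem_closure_of_tendsto hlim (Filter.Eventually.of_forall fun t ↦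
        ⟨t • v, Y.smul_mem _ hvY, rfl⟩)

variable [FiniteDimensional ℝ X] [Nontrivial X]

/-- The smooth structure on `X̄` for which `Θ` is a diffeomorphism: its charts are those of the
half-sphere composed with `Θ`. -/
instance : ChartedSpace (Orthant (finrank ℝ X) 1) (SphericalCompactification X) where
  atlas := {φ | ∃ ψ ∈ atlas (Orthant (finrank ℝ X) 1) (HalfSphere X),
    φ = (thetaHomeomorph X).transOpenPartialHomeomorph ψ}
  chartAt q := (thetaHomeomorph X).transOpenPartialHomeomorph (chartAt _ (thetaHomeomorph X q))
  mem_chart_source q := mem_chart_source _ (thetaHomeomorph X q)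
  chart_mem_atlas _ := ⟨_, chart_mem_atlas _ _, rfl⟩

/-- The compactification `X̄` is a smooth manifold with boundary. -/
instance : IsManifold (orthantModel (finrank ℝ X) 1) ∞ (SphericalCompactification X) where
  compatible := by
    rintro _ _ ⟨ψ, hψ, rfl⟩ ⟨ψ', hψ', rfl⟩
    have h := HasGroupoid.compatible (G := contDiffGroupoid ∞ (orthantModel (finrank ℝ X) 1)) hψ hψ'
    convert! h using 1
    ext x
    · simp
    · simp
    · simp

end SphericalCompactification

end

open Set Module
open scoped Manifold ContDiff

/-! Composing `Θ` with the inclusion of the half-sphere embeds the compactification in `ℝ × X`, and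
both kinds of sets become traces of linear subspaces: the closure of `Y` is the preimage of `ℝ × Y`,
and its sphere at infinity is the preimage of `0 × Y`. Intersections are therefore computed among
linear subspaces, and a mixed intersection is again a sphere at infinity.

Cleanness is linear algebra once `tangentSubspace_preimage` is known: the tangent space at `q` of
the preimage of a subspace `W` is the preimage of `W` under the differential of the embedding, and
taking preimages under a linear map commutes with intersections.

For the p-submanifold property, take `Y ≠ 0` and an orthonormal basis whose first vectors span `Y`.
Stereographic projection from `(0, ± b 0)` rescales by a nonzero factor the coordinate `t` and those
along `b i`, `i ≠ 0`. Since `b 0` lies in `Y`, the equations of `ℝ × Y` and `0 × Y` involve only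
these coordinates, so they become coordinate equations in the chart (`isPSubmanifold_of_mem_iff`).
For `Y = 0` the sphere is empty and the closure is the single interior point `0`, handled by the
affine chart. -/

namespace SphericalCompactification

attribute [local instance] neZero_finrank

/-! ### The embedding in `ℝ × X` and tangent spaces of traces of linear subspaces. -/

section Embed

variable {X : Type*} [NormedAddCommGroup X] [InnerProductSpace ℝ X]

/-- The embedding `X̄ → ℝ × X` given by `Θ`. -/
noncomputable def embed (q : SphericalCompactification X) : ℝ × X := (theta q).1

theorem embed_mem_sphere (q : SphericalCompactification X) :
    (embed q).1 ^ 2 + ‖(embed q).2‖ ^ 2 = 1 := (theta q).2.1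

theorem embed_fst_nonneg (q : SphericalCompactification X) : 0 ≤ (embed q).1 := (theta q).2.2

theorem isInducing_embed : Topology.IsInducing (embed : SphericalCompactification X → ℝ × X) :=
  Topology.IsInducing.subtypeVal.comp (thetaHomeomorph X).isInducing

theorem embed_injective : Function.Injective (embed : SphericalCompactification X → ℝ × X) :=
  Subtype.val_injective.comp (thetaEquiv X).injective

/-- `Θ` only multiplies `(1, x)` or `(0, v)` by a positive scalar, which does not affect membership
in a linear subspace. -/
theorem compactification_eq_preimage (Y : Submodule ℝ X) :
    compactification Y = embed ⁻¹' ((⊤ : Submodule ℝ ℝ).prod Y) := by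
  ext q
  cases q with
  | ofPoint x =>
    have h : (√(1 + ‖x‖ ^ 2))⁻¹ ≠ 0 := by positivity
    simp [compactification, sphereAtInfinity, embed, theta, Y.smul_mem_iff h]
  | ofRay r =>
    induction r using Module.Ray.ind with
    | h v hv =>
    have hn : ‖v‖⁻¹ ≠ 0 := inv_ne_zero (norm_ne_zero_iff.2 hv)
    simp only [compactification, sphereAtInfinity, mem_union, mem_image, reduceCtorEq, and_false,
      exists_false, false_or, mem_preimage, embed, theta_ofRay, Prod.smul_mk, SetLike.mem_coe,
      Submodule.mem_prod, Submodule.mem_top, true_and,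
      Y.smul_mem_iff hn, mem_ofPred_eq, ofRay.injEq]
    constructor
    -- The vector of `Y` spanning the ray need not be `v`, but it differs from `v` by a positive
    -- factor.
    · rintro ⟨u, hu, huY, h⟩
      obtain ⟨a, -, ha⟩ := ((ray_eq_iff hv hu).1 h).symm.exists_pos_left hu hv
      rw [← ha]
      exact Y.smul_mem _ huY
    · intro h
      exact ⟨v, hv, h, rfl⟩

theorem sphereAtInfinity_eq_preimage (Y : Submodule ℝ X) :
    sphereAtInfinity Y = embed ⁻¹' ((⊥ : Submodule ℝ ℝ).prod Y) := by
  have h : sphereAtInfinity Y = compactification Y ∩ {q | (embed q).1 = 0} := by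
    ext q
    cases q with
    | ofPoint x =>
      have h : √(1 + ‖x‖ ^ 2) ≠ 0 := by positivity
      simp [sphereAtInfinity, embed, theta, h]
    | ofRay r => simp [compactification, embed, theta]
  rw [h, compactification_eq_preimage]
  ext q
  simp [and_comm]

/-- The point of `X̄` in the direction of a nonzero `p ∈ [0, ∞) × X`. -/
noncomputable def ofDirection (p : ℝ × X) : SphericalCompactification X :=
  open Classical in
  if h : p ≠ 0 ∧ 0 ≤ p.1 then (thetaEquiv X).symm ⟨(√(p.1 ^ 2 + ‖p.2‖ ^ 2))⁻¹ • p, by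
    have h0 : 0 < p.1 ^ 2 + ‖p.2‖ ^ 2 := by
      by_cases h1 : p.1 = 0
      · have h2 : p.2 ≠ 0 := fun h2 ↦ h.1 (Prod.ext h1 h2)
        have := norm_pos_iff.2 h2
        positivity
      · positivity
    simp only [Prod.smul_fst, Prod.smul_snd, smul_eq_mul, norm_smul, norm_inv, Real.norm_eq_abs,
      mul_pow, inv_pow, sq_abs, Real.sq_sqrt h0.le]
    field_simp, by
    have := h.2
    simp only [Prod.smul_fst, smul_eq_mul]
    positivity⟩
  else ofPoint 0

theorem embed_ofDirection {p : ℝ × X} (hp : p ≠ 0) (hp' : 0 ≤ p.1) :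
    embed (ofDirection p) = (√(p.1 ^ 2 + ‖p.2‖ ^ 2))⁻¹ • p := by
  rw [ofDirection, dif_pos ⟨hp, hp'⟩]
  exact congrArg Subtype.val ((thetaEquiv X).apply_symm_apply _)

theorem isOpen_halfStereo_domain {n : ℕ} [NeZero n] (b : OrthonormalBasis (Fin n) ℝ X) (s : ℝ) :
    IsOpen {p : ℝ × X | s * b.repr p.2 0 ≠ 1} := by
  apply isOpen_ne_fun <;> fun_prop

variable [FiniteDimensional ℝ X] [Nontrivial X]

/-- The chart is the restriction of a map defined on an open subset of the vector space `ℝ × X`;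
this reduces smoothness on the compactification to ordinary calculus there. -/
theorem exists_extChartAt_eq (q : SphericalCompactification X) :
    ∃ s : ℝ, s * s = 1 ∧
      (extChartAt (orthantModel (finrank ℝ X) 1) q).source =
        {q' | s * (stdOrthonormalBasis ℝ X).repr (embed q').2 0 ≠ 1} ∧
      ⇑(extChartAt (orthantModel (finrank ℝ X) 1) q) =
        halfStereo (stdOrthonormalBasis ℝ X) s ∘ embed := by
  obtain ⟨s, hs, h⟩ := chart_mem_atlas (Orthant (finrank ℝ X) 1) (thetaHomeomorph X q)
  have hq : chartAt (Orthant (finrank ℝ X) 1) q =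
      (thetaHomeomorph X).transOpenPartialHomeomorph (chartAt _ (thetaHomeomorph X q)) := rfl
  refine ⟨s, hs, ?_, ?_⟩
  · rw [extChartAt_source, hq, h]
    rfl
  · rw [extChartAt_coe, hq, h]
    rfl

/-- Near `q` the embedding is the chart followed by the inverse stereographic projection, which is
smooth on all of `ℝⁿ`. -/
theorem contMDiff_embed :
    ContMDiff (orthantModel (finrank ℝ X) 1) 𝓘(ℝ, ℝ × X) ∞
      (embed : SphericalCompactification X → ℝ × X) := by
  intro q
  obtain ⟨s, hs, h1, h2⟩ := exists_extChartAt_eq q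
  have h := (contDiff_halfStereoInv (b := stdOrthonormalBasis ℝ X)
    (s := s)).contMDiff.contMDiffAt.comp q (contMDiffAt_extChartAt (I := orthantModel (finrank ℝ X) 1) (n := ∞) (x := q))
  refine h.congr_of_eventuallyEq ?_
  filter_upwards [extChartAt_source_mem_nhds (I := orthantModel (finrank ℝ X) 1) q] with q' hq'
  rw [h1] at hq'
  rw [h2]
  exact (halfStereoInv_halfStereo hs (embed_mem_sphere q') hq').symm

/-- A map into `X̄` is smooth as soon as its composition with the embedding is. -/
theorem contMDiffOn_of_embed {E H N : Type*} [NormedAddCommGroup E] [NormedSpace ℝ E]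
    [TopologicalSpace H] {J : ModelWithCorners ℝ E H} [TopologicalSpace N] [ChartedSpace H N]
    {f : N → SphericalCompactification X} {t : Set N}
    (hf : ContMDiffOn J 𝓘(ℝ, ℝ × X) ∞ (embed ∘ f) t) :
    ContMDiffOn J (orthantModel (finrank ℝ X) 1) ∞ f t := by
  intro x hx
  rw [contMDiffWithinAt_iff_target]
  refine ⟨isInducing_embed.continuousWithinAt_iff.2 (hf x hx).continuousWithinAt, ?_⟩
  obtain ⟨s, hs, h1, h2⟩ := exists_extChartAt_eq (f x)
  have hmem := mem_extChartAt_source (I := orthantModel (finrank ℝ X) 1) (f x)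
  rw [h1] at hmem
  rw [h2, Function.comp_assoc]
  -- Stereographic projection is smooth on an open subset of `ℝ × X`, not merely along the sphere,
  -- so smoothness of `embed ∘ f` as a map into the ambient space suffices.
  exact (contDiffOn_halfStereo.contDiffAt
    ((isOpen_halfStereo_domain _ s).mem_nhds hmem)).contMDiffAt.comp_contMDiffWithinAt x (hf x hx)

variable (X) in
/-- The differential of the embedding. -/
noncomputable abbrev embedDeriv (q : SphericalCompactification X) :
    TangentSpace (orthantModel (finrank ℝ X) 1) q →L[ℝ] ℝ × X :=
  mfderiv (orthantModel (finrank ℝ X) 1) 𝓘(ℝ, ℝ × X) embed q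

/-- The differential of a chart is invertible and factors through that of `embed`. -/
theorem embedDeriv_injective (q : SphericalCompactification X) :
    Function.Injective (embedDeriv X q) := by
  obtain ⟨s, hs, h1, h2⟩ := exists_extChartAt_eq q
  have hmem := mem_extChartAt_source (I := orthantModel (finrank ℝ X) 1) q
  have hinv := (isInvertible_mfderiv_extChartAt (I := orthantModel (finrank ℝ X) 1) hmem).injective
  rw [h1] at hmem
  have hd : MDifferentiableAt 𝓘(ℝ, ℝ × X) 𝓘(ℝ, EuclideanSpace ℝ (Fin (finrank ℝ X)))
      (halfStereo (stdOrthonormalBasis ℝ X) s) (embed q) :=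
    (contDiffOn_halfStereo.contDiffAt
      ((isOpen_halfStereo_domain _ s).mem_nhds hmem)).contMDiffAt.mdifferentiableAt (by simp)
  rw [h2, mfderiv_comp q hd (contMDiff_embed.mdifferentiableAt (by simp))] at hinv
  exact Function.Injective.of_comp hinv

/-- Differentiate the equation `t² + ‖x‖² = 1`. -/
theorem embedDeriv_orthogonal (q : SphericalCompactification X)
    (v : TangentSpace (orthantModel (finrank ℝ X) 1) q) :
    (embed q).1 * (embedDeriv X q v).1 + inner ℝ (embed q).2 (embedDeriv X q v).2 = 0 := by
  have hN : HasFDerivAt (fun p : ℝ × X ↦ p.1 ^ 2 + ‖p.2‖ ^ 2) _ (embed q) :=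
    ((hasFDerivAt_fst (𝕜 := ℝ)).pow 2).add (hasFDerivAt_snd (𝕜 := ℝ)).norm_sq
  have hc : (fun p : ℝ × X ↦ p.1 ^ 2 + ‖p.2‖ ^ 2) ∘ embed = fun _ ↦ (1 : ℝ) :=
    funext embed_mem_sphere
  have h := (mfderiv_comp q hN.hasMFDerivAt.mdifferentiableAt
    (contMDiff_embed.mdifferentiableAt (I := orthantModel (finrank ℝ X) 1) (by simp)))
  rw [hc, mfderiv_const, hN.hasMFDerivAt.mfderiv] at h
  have h' := DFunLike.congr_fun h v
  have h'' : (0 : ℝ) = 2 * ((embed q).1 * (embedDeriv X q v).1) +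
      2 * inner ℝ (embed q).2 (embedDeriv X q v).2 := by
    refine h'.trans ?_
    change (2 • (embed q).1 ^ (2 - 1)) * (embedDeriv X q v).1 +
      2 • inner ℝ (embed q).2 (embedDeriv X q v).2 = _
    simp [mul_assoc]
  linarith

/-- Curves and their velocities can be tested in `ℝ × X`: a curve is smooth when its image is, and
injectivity of the differential recovers `v`. This also removes the transport along `γ 0 = q`. -/
theorem mem_inwardTangentVectors_iff {P : Set (SphericalCompactification X)}
    {q : SphericalCompactification X} {v : TangentSpace (orthantModel (finrank ℝ X) 1) q} :
    v ∈ inwardTangentVectors (orthantModel (finrank ℝ X) 1) P q ↔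
      ∃ (γ : ℝ → SphericalCompactification X) (ε : ℝ), γ 0 = q ∧ 0 < ε ∧
        ContDiffOn ℝ ∞ (embed ∘ γ) (Ico 0 ε) ∧ MapsTo γ (Ico 0 ε) P ∧
        embedDeriv X q v = derivWithin (embed ∘ γ) (Ico 0 ε) 0 := by
  have key (γ : ℝ → SphericalCompactification X) (ε : ℝ) (hε : 0 < ε)
      (hγ : ContMDiffOn 𝓘(ℝ, ℝ) (orthantModel (finrank ℝ X) 1) ∞ γ (Ico 0 ε)) :
      embedDeriv X (γ 0) (mfderivWithin 𝓘(ℝ, ℝ) (orthantModel (finrank ℝ X) 1) γ (Ico 0 ε) 0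
        (1 : ℝ)) = derivWithin (embed ∘ γ) (Ico 0 ε) 0 := by
    have h0 : (0 : ℝ) ∈ Ico 0 ε := ⟨le_rfl, hε⟩
    have hu : UniqueMDiffWithinAt 𝓘(ℝ, ℝ) (Ico 0 ε) 0 :=
      (uniqueDiffOn_Ico 0 ε 0 h0).uniqueMDiffWithinAt
    have h := mfderiv_comp_mfderivWithin (0 : ℝ)
      (contMDiff_embed.mdifferentiableAt (I := orthantModel (finrank ℝ X) 1) (x := γ 0) (by simp))
      ((hγ 0 h0).mdifferentiableWithinAt (by simp)) hu
    rw [← fderivWithin_derivWithin, ← mfderivWithin_eq_fderivWithin, h]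
    rfl
  constructor
  · rintro ⟨γ, ε, rfl, hε, hγ, hP, rfl⟩
    exact ⟨γ, ε, rfl, hε, (contMDiff_embed.comp_contMDiffOn hγ).contDiffOn, hP, key γ ε hε hγ⟩
  · rintro ⟨γ, ε, rfl, hε, hγ, hP, hv⟩
    have hγ' := contMDiffOn_of_embed hγ.contMDiffOn
    exact ⟨γ, ε, rfl, hε, hγ', hP, embedDeriv_injective _ (hv.trans (key γ ε hε hγ').symm)⟩

/-- With `w` the image of `v`, the segment `embed q + r • w` stays in `W`, and so does its radial
projection to the sphere. The condition `hin` keeps it in `t ≥ 0` for small `r ≥ 0`. -/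
theorem mem_inwardTangentVectors_preimage (W : Submodule ℝ (ℝ × X))
    {q : SphericalCompactification X} (hq : embed q ∈ W)
    {v : TangentSpace (orthantModel (finrank ℝ X) 1) q} (hv : embedDeriv X q v ∈ W)
    (hin : 0 < (embed q).1 ∨ 0 ≤ (embedDeriv X q v).1) :
    v ∈ inwardTangentVectors (orthantModel (finrank ℝ X) 1) (embed ⁻¹' W) q := by
  rw [mem_inwardTangentVectors_iff]
  have horth := embedDeriv_orthogonal q v
  generalize embedDeriv X q v = w at hv hin horth ⊢
  have hnonneg := embed_fst_nonneg q
  obtain ⟨ε, hε, hpos⟩ : ∃ ε : ℝ, 0 < ε ∧ ∀ r ∈ Ico 0 ε, 0 ≤ (embed q).1 + r * w.1 := by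
    by_cases hw : 0 ≤ w.1
    · exact ⟨1, one_pos, fun r hr ↦ by have := hr.1; positivity⟩
    · have h0 := hin.resolve_right hw
      push Not at hw
      -- The time at which the line reaches the hyperplane `t = 0`.
      refine ⟨(embed q).1 / -w.1, div_pos h0 (by linarith), fun r hr ↦ ?_⟩
      have := (lt_div_iff₀ (by linarith)).1 hr.2
      linarith
  -- The cross term vanishes because `w` is orthogonal to `embed q`. Hence the normalizing factor is
  -- `1` with zero derivative at `r = 0`, and the projected curve has velocity exactly `w`.
  have hsq (r : ℝ) : (embed q + r • w).1 ^ 2 + ‖(embed q + r • w).2‖ ^ 2 =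
      1 + r ^ 2 * (w.1 ^ 2 + ‖w.2‖ ^ 2) := by
    simp only [Prod.fst_add, Prod.snd_add, Prod.smul_fst, Prod.smul_snd, smul_eq_mul,
      norm_add_sq_real, inner_smul_right, norm_smul, mul_pow, Real.norm_eq_abs, sq_abs]
    linear_combination embed_mem_sphere q + 2 * r * horth
  have hsqpos (r : ℝ) : 0 < 1 + r ^ 2 * (w.1 ^ 2 + ‖w.2‖ ^ 2) := by positivity
  have hne (r : ℝ) : embed q + r • w ≠ 0 := by
    intro h
    have := hsqpos r
    rw [← hsq, h] at this
    simp at this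
  have hembed : ∀ r ∈ Ico 0 ε, embed (ofDirection (embed q + r • w)) =
      (√(1 + r ^ 2 * (w.1 ^ 2 + ‖w.2‖ ^ 2)))⁻¹ • (embed q + r • w) := fun r hr ↦ by
    rw [embed_ofDirection (hne r) (by simpa using hpos r hr), hsq]
  have h0 : (0 : ℝ) ∈ Ico 0 ε := ⟨le_rfl, hε⟩
  refine ⟨fun r ↦ ofDirection (embed q + r • w), ε, ?_, hε, ?_, ?_, ?_⟩
  · apply embed_injective
    rw [hembed 0 h0]
    simp
  · refine ContDiffOn.congr (f := fun r ↦ (√(1 + r ^ 2 * (w.1 ^ 2 + ‖w.2‖ ^ 2)))⁻¹ •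
      (embed q + r • w)) (ContDiff.contDiffOn ?_) hembed
    have h1 : ContDiff ℝ ∞ fun r : ℝ ↦ 1 + r ^ 2 * (w.1 ^ 2 + ‖w.2‖ ^ 2) := by fun_prop
    exact ((h1.sqrt fun r ↦ (hsqpos r).ne').inv fun r ↦ (Real.sqrt_pos.2 (hsqpos r)).ne').smul
      (by fun_prop)
  · intro r hr
    rw [mem_preimage, hembed r hr]
    exact W.smul_mem _ (W.add_mem hq (W.smul_mem _ hv))
  · symm
    refine HasDerivWithinAt.derivWithin ?_ (uniqueDiffOn_Ico 0 ε 0 h0)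
    refine HasDerivWithinAt.congr_of_mem (HasDerivAt.hasDerivWithinAt ?_) hembed h0
    have h1 : HasDerivAt (fun r : ℝ ↦ 1 + r ^ 2 * (w.1 ^ 2 + ‖w.2‖ ^ 2)) 0 0 := by
      simpa using ((hasDerivAt_pow 2 (0 : ℝ)).mul_const (w.1 ^ 2 + ‖w.2‖ ^ 2)).const_add 1
    have h2 := (h1.sqrt (hsqpos 0).ne').inv (Real.sqrt_pos.2 (hsqpos 0)).ne'
    have h3 := h2.smul (((hasDerivAt_id (0 : ℝ)).smul_const w).const_add (embed q))
    refine h3.congr_deriv ?_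
    simp

/-- Velocities of curves in `W` lie in `W`; conversely, at least one of `v` and `-v` is the velocity
of a normalized segment. No transversality of `W` to the boundary is needed. -/
theorem tangentSubspace_preimage (W : Submodule ℝ (ℝ × X)) {q : SphericalCompactification X}
    (hq : embed q ∈ W) :
    tangentSubspace (orthantModel (finrank ℝ X) 1) (embed ⁻¹' W) q =
      W.comap (embedDeriv X q).toLinearMap := by
  apply le_antisymm
  · refine Submodule.span_le.2 fun v hv ↦ ?_
    obtain ⟨γ, ε, rfl, hε, hγ, hP, hv⟩ := mem_inwardTangentVectors_iff.1 hv
    have h0 : (0 : ℝ) ∈ Ico 0 ε := ⟨le_rfl, hε⟩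
    change embedDeriv X (γ 0) v ∈ W
    have hd := ((hγ 0 h0).differentiableWithinAt (by simp)).hasDerivWithinAt
    rw [hv]
    -- The velocity is a limit of difference quotients, which lie in the closed subspace `W`.
    rw [hasDerivWithinAt_iff_tendsto_slope] at hd
    have : (nhdsWithin (0 : ℝ) (Ico 0 ε \ {0})).NeBot := by
      have : Ico 0 ε \ {0} = Ioo 0 ε := by
        ext r
        simp only [mem_sdiff, mem_Ico, mem_singleton_iff, mem_Ioo]
        constructor
        · rintro ⟨⟨h1, h2⟩, h3⟩
          exact ⟨lt_of_le_of_ne h1 (Ne.symm h3), h2⟩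
        · rintro ⟨h1, h2⟩
          exact ⟨⟨h1.le, h2⟩, h1.ne'⟩
      rw [this]
      exact left_nhdsWithin_Ioo_neBot hε
    refine W.closed_of_finiteDimensional.mem_of_tendsto hd ?_
    filter_upwards [self_mem_nhdsWithin] with r hr
    exact W.smul_mem _ (W.sub_mem (hP hr.1) (hP h0))
  · intro v hv
    by_cases hin : 0 ≤ (embedDeriv X q v).1
    · exact Submodule.subset_span (mem_inwardTangentVectors_preimage W hq hv (Or.inr hin))
    -- An outward pointing `v` need not be a velocity, but `-v` then points inward, and the span
    -- contains both.
    · rw [← Submodule.neg_mem_iff]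
      refine Submodule.subset_span (mem_inwardTangentVectors_preimage W hq
        (v := -v) ?_ (Or.inr ?_))
      · rw [map_neg]
        exact W.neg_mem hv
      · rw [map_neg]
        push Not at hin
        simpa using hin.le

end Embed

/-! ### Adapted charts and the p-submanifold property. -/

section Charts

/-- A map into `ℝⁿ_k` is smooth if it is so as a map into `ℝⁿ`. -/
theorem contMDiffOn_orthant_of_val {n k : ℕ} {E H N : Type*} [NormedAddCommGroup E]
    [NormedSpace ℝ E] [TopologicalSpace H] {J : ModelWithCorners ℝ E H} [TopologicalSpace N]
    [ChartedSpace H N] {f : N → Orthant n k} {t : Set N}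
    (hf : ContMDiffOn J 𝓘(ℝ, EuclideanSpace ℝ (Fin n)) ∞ (fun x ↦ (f x).1) t) :
    ContMDiffOn J (orthantModel n k) ∞ f t := by
  intro x hx
  rw [contMDiffWithinAt_iff_target]
  refine ⟨Topology.IsInducing.subtypeVal.continuousWithinAt_iff.2
    (hf x hx).continuousWithinAt, ?_⟩
  simp only [mfld_simps]
  exact hf x hx

theorem contMDiff_orthant_val (n k : ℕ) :
    ContMDiff (orthantModel n k) 𝓘(ℝ, EuclideanSpace ℝ (Fin n)) ∞
      (Subtype.val : Orthant n k → EuclideanSpace ℝ (Fin n)) :=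
  (orthantModel n k).contMDiff

variable {X : Type*} [NormedAddCommGroup X] [InnerProductSpace ℝ X] [FiniteDimensional ℝ X]

/-- An orthonormal basis of `X` whose first vectors form a basis of `Y`. -/
theorem exists_orthonormalBasis_mem_iff (Y : Submodule ℝ X) :
    ∃ b : OrthonormalBasis (Fin (finrank ℝ X)) ℝ X, ∀ x,
      x ∈ Y ↔ ∀ i : Fin (finrank ℝ X), finrank ℝ Y ≤ i → b.repr x i = 0 := by
  let c := stdOrthonormalBasis ℝ Y
  let v : Fin (finrank ℝ X) → X := fun i ↦
    if h : (i : ℕ) < finrank ℝ Y then (c ⟨i, h⟩ : X) else 0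
  let s : Set (Fin (finrank ℝ X)) := {i | (i : ℕ) < finrank ℝ Y}
  have hv : Orthonormal ℝ (s.domRestrict v) := by
    have hc : Orthonormal ℝ fun j ↦ (c j : X) := c.orthonormal.comp_linearIsometry Y.subtypeₗᵢ
    have := hc.comp (fun i : s ↦ (⟨(i : Fin (finrank ℝ X)), i.2⟩ : Fin (finrank ℝ Y)))
      fun i j h ↦ Subtype.ext (Fin.ext (by simpa using h))
    convert this using 1
    ext i
    have hi : ((i : Fin (finrank ℝ X)) : ℕ) < finrank ℝ Y := i.2
    simp only [domRestrict_apply, v, hi, dite_true, Function.comp_apply]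
  obtain ⟨b, hb⟩ := hv.exists_orthonormalBasis_extension_of_card_eq (by simp)
  refine ⟨b, fun x ↦ ⟨fun hx i hi ↦ ?_, fun h ↦ ?_⟩⟩
  · have hsum := congrArg Subtype.val (c.sum_repr ⟨x, hx⟩)
    rw [Submodule.coe_sum] at hsum
    rw [b.repr_apply_apply, show x = _ from hsum.symm, inner_sum]
    refine Finset.sum_eq_zero fun j _ ↦ ?_
    have hj : (j : ℕ) < finrank ℝ X := j.2.trans_le (Submodule.finrank_le Y)
    have hbj : b ⟨j, hj⟩ = c j := by
      rw [hb ⟨j, hj⟩ j.2]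
      simp [v]
    rw [Submodule.coe_smul, ← hbj, inner_smul_right, b.inner_eq_zero, mul_zero]
    intro h
    have := j.2
    rw [h] at hi
    simp at hi
    lia
  · rw [← b.sum_repr x]
    refine Y.sum_mem fun i _ ↦ ?_
    by_cases hi : (i : ℕ) < finrank ℝ Y
    · refine Y.smul_mem _ ?_
      rw [hb i hi]
      simp [v, hi]
    · rw [h i (not_lt.1 hi), zero_smul]
      exact Y.zero_mem

variable [Nontrivial X]

/-- Stereographic projection as a chart of `X̄`. -/
noncomputable def stereoChart (b : OrthonormalBasis (Fin (finrank ℝ X)) ℝ X) (s : ℝ)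
    (hs : s * s = 1) :
    OpenPartialHomeomorph (SphericalCompactification X) (Orthant (finrank ℝ X) 1) :=
  (thetaHomeomorph X).transOpenPartialHomeomorph (halfSphereChart b s hs)

theorem isCornerChart_stereoChart (b : OrthonormalBasis (Fin (finrank ℝ X)) ℝ X) (s : ℝ)
    (hs : s * s = 1) : IsCornerChart (orthantModel (finrank ℝ X) 1) (stereoChart b s hs) where
  contMDiffOn := contMDiffOn_orthant_of_val
    ((contDiffOn_halfStereo (b := b) (s := s)).contMDiffOn.comp contMDiff_embed.contMDiffOn
      fun _ hq ↦ hq)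
  contMDiffOn_symm := by
    refine contMDiffOn_of_embed (((contDiff_halfStereoInv (b := b) (s := s)).contMDiff.comp
      (contMDiff_orthant_val _ _)).contMDiffOn.congr fun w _ ↦ ?_)
    exact congrArg Subtype.val ((thetaHomeomorph X).apply_symm_apply _)

/-- Stereographic projection is `swapCoord` times a nonzero scalar, so the vanishing of any of these
coordinates can be read in the chart. -/
theorem isPSubmanifold_of_mem_iff {P : Set (SphericalCompactification X)}
    (b : OrthonormalBasis (Fin (finrank ℝ X)) ℝ X) (J : Finset (Fin (finrank ℝ X)))
    (hP : ∀ q, q ∈ P ↔ ∀ i ∈ J, swapCoord b (embed q) i = 0) :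
    IsPSubmanifold (orthantModel (finrank ℝ X) 1) P := by
  intro q _
  -- Project from whichever of the poles `(0, ± b 0)` is not on the side of `q`.
  obtain ⟨s, hs, hq⟩ : ∃ s : ℝ, s * s = 1 ∧ s * b.repr (embed q).2 0 ≠ 1 := by
    by_cases h : b.repr (embed q).2 0 ≤ 0
    · exact ⟨1, by norm_num, by linarith⟩
    · exact ⟨-1, by norm_num, by linarith⟩
  refine ⟨1, finrank_pos, stereoChart b s hs, J, isCornerChart_stereoChart b s hs, hq, ?_⟩
  have him : (stereoChart b s hs).IsImage P (orthantFace J) := by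
    intro q' hq'
    have hD : (1 - s * b.repr (embed q').2 0)⁻¹ ≠ 0 :=
      inv_ne_zero fun h ↦ (show s * b.repr (embed q').2 0 ≠ 1 from hq') (by linarith)
    rw [hP]
    change (∀ i ∈ J, halfStereo b s (embed q') i = 0) ↔ _
    simp [halfStereo, hD]
  rw [inter_comm, him.image_eq, inter_comm]

/-- The affine chart `X → ℝⁿ` of `X̄`. -/
noncomputable def affineChart (b : OrthonormalBasis (Fin (finrank ℝ X)) ℝ X) :
    OpenPartialHomeomorph (SphericalCompactification X) (Orthant (finrank ℝ X) 0) where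
  toFun q := ⟨b.repr ((embed q).1⁻¹ • (embed q).2), fun _ h ↦ absurd h (Nat.not_lt_zero _)⟩
  invFun w := ofPoint (b.repr.symm w.1)
  source := {q | (embed q).1 ≠ 0}
  target := univ
  map_source' _ _ := mem_univ _
  map_target' w _ := by
    have h : √(1 + ‖b.repr.symm w.1‖ ^ 2) ≠ 0 := by positivity
    simpa [embed, theta] using h
  left_inv' q hq := by
    cases q with
    | ofPoint x =>
      have h : √(1 + ‖x‖ ^ 2) ≠ 0 := by positivity
      simp [embed, theta, smul_smul, h]
    | ofRay r => simp [embed, theta] at hq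
  right_inv' w _ := by
    have h : √(1 + ‖b.repr.symm w.1‖ ^ 2) ≠ 0 := by positivity
    apply Subtype.ext
    simp only [embed, theta, Prod.smul_fst, Prod.smul_snd, smul_eq_mul, mul_one, smul_smul, inv_inv,
      mul_inv_cancel₀ h, one_smul, b.repr.apply_symm_apply]
  open_source := isOpen_ne_fun (continuous_fst.comp isInducing_embed.continuous) continuous_const
  open_target := isOpen_univ
  continuousOn_toFun := by
    refine Topology.IsInducing.subtypeVal.continuousOn_iff.2 ?_
    have h := (isInducing_embed (X := X)).continuous
    exact b.repr.continuous.comp_continuousOn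
      (((continuous_fst.comp h).continuousOn.inv₀ fun q hq ↦ hq).smul
        (continuous_snd.comp h).continuousOn)
  continuousOn_invFun := by
    refine Continuous.continuousOn (isInducing_embed.continuous_iff.2 ?_)
    change Continuous fun w : Orthant (finrank ℝ X) 0 ↦
      (√(1 + ‖b.repr.symm w.1‖ ^ 2))⁻¹ • ((1 : ℝ), b.repr.symm w.1)
    have h : Continuous fun w : Orthant (finrank ℝ X) 0 ↦ b.repr.symm w.1 :=
      b.repr.symm.continuous.comp continuous_subtype_val
    have h2 : Continuous fun w : Orthant (finrank ℝ X) 0 ↦ √(1 + ‖b.repr.symm w.1‖ ^ 2) :=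
      (continuous_const.add (h.norm.pow 2)).sqrt
    exact (h2.inv₀ fun w ↦ by positivity).smul (continuous_const.prodMk h)

theorem isCornerChart_affineChart (b : OrthonormalBasis (Fin (finrank ℝ X)) ℝ X) :
    IsCornerChart (orthantModel (finrank ℝ X) 1) (affineChart b) where
  contMDiffOn := by
    have h : ContDiffOn ℝ ∞ (fun p : ℝ × X ↦ b.repr (p.1⁻¹ • p.2)) {p | p.1 ≠ 0} :=
      b.repr.contDiff.comp_contDiffOn ((contDiff_fst.contDiffOn.inv fun p hp ↦ hp).smul
        contDiff_snd.contDiffOn)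
    exact contMDiffOn_orthant_of_val
      (h.contMDiffOn.comp contMDiff_embed.contMDiffOn fun _ hq ↦ hq)
  contMDiffOn_symm := by
    have h : ContDiff ℝ ∞ fun w : EuclideanSpace ℝ (Fin (finrank ℝ X)) ↦
        (√(1 + ‖b.repr.symm w‖ ^ 2))⁻¹ • ((1 : ℝ), b.repr.symm w) := by
      have h1 : ContDiff ℝ ∞ b.repr.symm := b.repr.symm.contDiff
      have h2 : ContDiff ℝ ∞ fun w ↦ 1 + ‖b.repr.symm w‖ ^ 2 :=
        contDiff_const.add (h1.norm_sq ℝ)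
      exact ((h2.sqrt fun w ↦ by positivity).inv fun w ↦ by positivity).smul
        (contDiff_const.prodMk h1)
    exact contMDiffOn_of_embed (h.contMDiff.comp (contMDiff_orthant_val _ _)).contMDiffOn

/-- The equation `x = 0` includes the coordinate along `b 0`, which `swapCoord` discards, so
`isPSubmanifold_of_mem_iff` does not apply. The point is interior, and the affine chart, with `k =
0`, sends it to the origin. -/
theorem isPSubmanifold_compactification_bot :
    IsPSubmanifold (orthantModel (finrank ℝ X) 1) (compactification (⊥ : Submodule ℝ X)) := by
  intro q hq
  let b := stdOrthonormalBasis ℝ X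
  rw [compactification_eq_preimage] at hq ⊢
  refine ⟨0, Nat.zero_le _, affineChart b, Finset.univ, isCornerChart_affineChart b, ?_, ?_⟩
  · intro h
    have h1 := embed_mem_sphere q
    have h2 : (embed q).2 = 0 := hq.2
    simp [h, h2] at h1
  · have him : (affineChart b).IsImage
        (embed ⁻¹' ((⊤ : Submodule ℝ ℝ).prod (⊥ : Submodule ℝ X))) (orthantFace Finset.univ) := by
      intro q' hq'
      have hq' : (embed q').1⁻¹ ≠ 0 := inv_ne_zero hq'
      have : (affineChart b q').1 = 0 ↔ (embed q').2 = 0 := by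
        change b.repr ((embed q').1⁻¹ • (embed q').2) = 0 ↔ _
        simp [hq']
      simp only [mem_preimage, SetLike.mem_coe, Submodule.mem_prod, Submodule.mem_top, true_and,
        Submodule.mem_bot]
      rw [← this, WithLp.ext_iff, funext_iff]
      simp [orthantFace]
    rw [inter_comm, him.image_eq, inter_comm]

theorem isPSubmanifold_compactification (Y : Submodule ℝ X) :
    IsPSubmanifold (orthantModel (finrank ℝ X) 1) (compactification Y) := by
  obtain rfl | hY := eq_or_ne Y ⊥
  · exact isPSubmanifold_compactification_bot
  obtain ⟨b, hb⟩ := exists_orthonormalBasis_mem_iff Y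
  have hpos : 0 < finrank ℝ Y := Submodule.one_le_finrank_iff.2 hY
  refine isPSubmanifold_of_mem_iff b
    (Finset.univ.filter fun i : Fin (finrank ℝ X) ↦ finrank ℝ Y ≤ i) fun q ↦ ?_
  rw [compactification_eq_preimage]
  simp only [mem_preimage, SetLike.mem_coe, Submodule.mem_prod, Submodule.mem_top, true_and, hb,
    Finset.mem_filter, Finset.mem_univ]
  refine forall_congr' fun i ↦ imp_congr_right fun hi ↦ ?_
  -- As `Y ≠ 0`, index `0` belongs to a basis vector of `Y`, so replacing that coordinate by `t`
  -- loses no equation.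
  have : i ≠ 0 := by
    rintro rfl
    simp at hi
    lia
  simp [swapCoord, this]

theorem isPSubmanifold_sphereAtInfinity (Y : Submodule ℝ X) :
    IsPSubmanifold (orthantModel (finrank ℝ X) 1) (sphereAtInfinity Y) := by
  obtain rfl | hY := eq_or_ne Y ⊥
  · rintro q ⟨v, hv, hv', -⟩
    exact absurd hv' hv
  obtain ⟨b, hb⟩ := exists_orthonormalBasis_mem_iff Y
  have hpos : 0 < finrank ℝ Y := Submodule.one_le_finrank_iff.2 hY
  refine isPSubmanifold_of_mem_iff b
    -- Index `0` contributes the equation `t = 0` of the boundary.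
    (insert 0 (Finset.univ.filter fun i : Fin (finrank ℝ X) ↦ finrank ℝ Y ≤ i)) fun q ↦ ?_
  rw [sphereAtInfinity_eq_preimage]
  simp only [mem_preimage, SetLike.mem_coe, Submodule.mem_prod, Submodule.mem_bot, hb,
    Finset.forall_mem_insert, Finset.mem_filter, Finset.mem_univ, true_and]
  refine and_congr (by simp [swapCoord]) (forall_congr' fun i ↦ imp_congr_right fun hi ↦ ?_)
  have : i ≠ 0 := by
    rintro rfl
    simp at hi
    lia
  simp [swapCoord, this]

end Charts

/-! ### Intersections and cleanness. -/

section Semilattice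

variable {X : Type*} [NormedAddCommGroup X] [InnerProductSpace ℝ X]

theorem preimage_inter (V V' : Submodule ℝ ℝ) (Y Z : Submodule ℝ X) :
    embed ⁻¹' (V.prod Y : Set (ℝ × X)) ∩ embed ⁻¹' (V'.prod Z : Set (ℝ × X)) =
      embed ⁻¹' ((V ⊓ V').prod (Y ⊓ Z) : Set (ℝ × X)) := by
  rw [← Submodule.prod_inf_prod]
  rfl

theorem compactification_inter (Y Z : Submodule ℝ X) :
    compactification Y ∩ compactification Z = compactification (Y ⊓ Z) := by
  simp only [compactification_eq_preimage, preimage_inter, inf_idem]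

theorem sphereAtInfinity_inter (Y Z : Submodule ℝ X) :
    sphereAtInfinity Y ∩ sphereAtInfinity Z = sphereAtInfinity (Y ⊓ Z) := by
  simp only [sphereAtInfinity_eq_preimage, preimage_inter, inf_idem]

theorem sphereAtInfinity_inter_compactification (Y Z : Submodule ℝ X) :
    sphereAtInfinity Y ∩ compactification Z = sphereAtInfinity (Y ⊓ Z) := by
  simp only [sphereAtInfinity_eq_preimage, compactification_eq_preimage, preimage_inter,
    bot_inf_eq]

variable [FiniteDimensional ℝ X] [Nontrivial X]

/-- A finite family of sets `Ȳ` and `𝕊_Y` that is stable under intersections is clean. -/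
theorem isCleanSemilattice_of_inter_mem {S : Set (Set (SphericalCompactification X))}
    (hfin : S.Finite) (hS : ∀ P ∈ S, ∃ Y, P = compactification Y ∨ P = sphereAtInfinity Y)
    (hinter : ∀ P ∈ S, ∀ Q ∈ S, P ∩ Q ∈ S) :
    IsCleanSemilattice (orthantModel (finrank ℝ X) 1) S := by
  have hP : ∀ P ∈ S, IsPSubmanifold (orthantModel (finrank ℝ X) 1) P := by
    intro P hP
    obtain ⟨Y, rfl | rfl⟩ := hS P hP
    · exact isPSubmanifold_compactification Y
    · exact isPSubmanifold_sphereAtInfinity Y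
  have hW : ∀ P ∈ S, ∃ W : Submodule ℝ (ℝ × X), P = embed ⁻¹' W := by
    intro P hP
    obtain ⟨Y, rfl | rfl⟩ := hS P hP
    · exact ⟨_, compactification_eq_preimage Y⟩
    · exact ⟨_, sphereAtInfinity_eq_preimage Y⟩
  refine ⟨hfin, hP, hinter, fun P hPS Q hQS ↦
    ⟨hP P hPS, hP Q hQS, hP _ (hinter P hPS Q hQS), fun q hq ↦ ?_⟩⟩
  obtain ⟨W, rfl⟩ := hW P hPS
  obtain ⟨W', rfl⟩ := hW Q hQS
  have hinf : embed ⁻¹' (W : Set (ℝ × X)) ∩ embed ⁻¹' (W' : Set (ℝ × X)) =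
      embed ⁻¹' ((W ⊓ W' : Submodule ℝ (ℝ × X)) : Set (ℝ × X)) := rfl
  -- All three tangent spaces are preimages under the same linear map, the differential of `embed`
  -- at `q`.
  rw [hinf, tangentSubspace_preimage _ hq, tangentSubspace_preimage _ hq.1,
    tangentSubspace_preimage _ hq.2, Submodule.comap_inf]

end Semilattice

end SphericalCompactification

open SphericalCompactification

/-- `X` is a finite-dimensional euclidean space and `F` a finite set of linear subspaces of `X`,
stable under intersections, with `{0} ∈ F` and `X ∉ F` (which forces `X ≠ 0`, so that
`[Nontrivial X]` is no restriction). -/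
theorem mainTheorem8 {X : Type*} [NormedAddCommGroup X] [InnerProductSpace ℝ X]
    [FiniteDimensional ℝ X] [Nontrivial X]
    (F : Set (Submodule ℝ X)) (hfin : F.Finite)
    (hinf : ∀ Y ∈ F, ∀ Z ∈ F, Y ⊓ Z ∈ F) (hbot : ⊥ ∈ F) (htop : ⊤ ∉ F) :
    IsCleanSemilattice (orthantModel (Module.finrank ℝ X) 1)
      (SphericalCompactification.compactifications F) ∧
    IsCleanSemilattice (orthantModel (Module.finrank ℝ X) 1)
      (SphericalCompactification.spheresAtInfinity F) ∧
    IsCleanSemilattice (orthantModel (Module.finrank ℝ X) 1)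
      (SphericalCompactification.spheresAtInfinity F ∪
        SphericalCompactification.compactifications F) := by
  have hc : ∀ P ∈ compactifications F, ∀ Q ∈ compactifications F, P ∩ Q ∈ compactifications F := by
    rintro _ ⟨Y, hY, rfl⟩ _ ⟨Z, hZ, rfl⟩
    exact ⟨_, hinf Y hY Z hZ, (compactification_inter Y Z).symm⟩
  have hs : ∀ P ∈ spheresAtInfinity F, ∀ Q ∈ spheresAtInfinity F, P ∩ Q ∈ spheresAtInfinity F := by
    rintro _ ⟨Y, hY, rfl⟩ _ ⟨Z, hZ, rfl⟩
    exact ⟨_, hinf Y hY Z hZ, (sphereAtInfinity_inter Y Z).symm⟩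
  -- Mixed intersections fall back among the spheres, since one factor already imposes `t = 0`; this
  -- makes the union stable.
  have hsc : ∀ P ∈ spheresAtInfinity F, ∀ Q ∈ compactifications F,
      P ∩ Q ∈ spheresAtInfinity F := by
    rintro _ ⟨Y, hY, rfl⟩ _ ⟨Z, hZ, rfl⟩
    exact ⟨_, hinf Y hY Z hZ, (sphereAtInfinity_inter_compactification Y Z).symm⟩
  have hcY : ∀ P ∈ compactifications F, ∃ Y, P = compactification Y ∨ P = sphereAtInfinity Y := by
    rintro _ ⟨Y, -, rfl⟩
    exact ⟨Y, Or.inl rfl⟩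
  have hsY : ∀ P ∈ spheresAtInfinity F, ∃ Y, P = compactification Y ∨ P = sphereAtInfinity Y := by
    rintro _ ⟨Y, -, rfl⟩
    exact ⟨Y, Or.inr rfl⟩
  refine ⟨isCleanSemilattice_of_inter_mem (hfin.image _) hcY hc,
    isCleanSemilattice_of_inter_mem (hfin.image _) hsY hs,
    isCleanSemilattice_of_inter_mem ((hfin.image _).union (hfin.image _))
      (fun P hP ↦ hP.elim (hsY P) (hcY P)) ?_⟩
  rintro P (hP | hP) Q (hQ | hQ)
  · exact Or.inl (hs P hP Q hQ)
  · exact Or.inl (hsc P hP Q hQ)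
  · rw [inter_comm]
    exact Or.inl (hsc Q hQ P hP)
  · exact Or.inr (hc P hP Q hQ)
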